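/- Let $d_{\mathrm{in}}, d_{\mathrm{out}}, n, r$ be dimensions, $X\in\mathbb{R}^{d_{\mathrm{in}}\times n}$ a fixed matrix and $\sigma:\mathbb{R}\to\mathbb{R}$ a function, applied to matrices entrywise. For $Y\in\mathbb{R}^{d_{\mathrm{out}}\times n}$ put $$\mathcal{E}_\sigma(r):=\min_{A\in\mathbb{R}^{r\times d_{\mathrm{in}}},\,B\in\mathbb{R}^{d_{\mathrm{out}}\times r}}\|Y-B\sigma(AX)\|_F .$$ Let $s_1\ge s_2\ge\cdots\ge 0$ be the singular values of $Y$ (with $s_j=0$ for $j>\operatorname{rank}(Y)$), $s_{>k}(Y):=\bigl(\sum_{j>k}s_j^2\bigr)^{1/2}$, and for $\alpha\in(0,1]$ let the effective rank $r_\alpha(Y)$ be the least $k\ge 0$ with $\sum_{j\le k}s_j^2\ge\alpha\sum_{j}s_j^2$. Theorem. There is an absolute constant $C>0$ such that the following holds. Let $A_{\mathrm{True}}\in\mathbb{R}^{r\times d_{\mathrm{in}}}$ and $B_{\mathrm{True}}\in\mathbb{R}^{d_{\mathrm{out}}\times r}$ be fixed, let $G$ be a random $d_{\mathrm{out}}\times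 n$ matrix with i.i.d. Gaussian entries of mean zero and variance $v^2$ ($v\ge 0$), and let $Y$ be a random $d_{\mathrm{out}}\times n$ matrix such that, almost surely, in spectral norm, $$\|Y-B_{\mathrm{True}}\,\sigma(A_{\mathrm{True}}X)-G\|_2\le\epsilon .$$ Then with probability at least $1-2\exp(-(n+d_{\mathrm{out}}))$, for all $\alpha\in(0,1]$ and all $(A^*,B^*)$ at which the optimal value $\mathcal{E}_\sigma(r)$ is attained, $$\|B_{\mathrm{True}}\sigma(A_{\mathrm{True}}X)-B^*\sigma(A^*X)\|_F\le\sqrt{r+r_\alpha(Y)}\,\bigl(Cv\sqrt{n+d_{\mathrm{out}}}+\epsilon+s_{r_\alpha(Y)+1}\bigr)+s_{>r_\alpha(Y)}(Y)+\mathcal{E}_\sigma(r).$$ -/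

import Mathlib

open MeasureTheory ProbabilityTheory
open scoped NNReal

section FrobeniusNorm

open scoped Matrix.Norms.Frobenius

/-- The Frobenius norm of a real matrix. -/
noncomputable def frobNorm {m n : ℕ} (M : Matrix (Fin m) (Fin n) ℝ) : ℝ := ‖M‖

/-- The Frobenius norm is the square root of the sum of the squared entries. -/
theorem frobNorm_eq_sqrt {m n : ℕ} (M : Matrix (Fin m) (Fin n) ℝ) :
    frobNorm M = √(∑ i, ∑ j, (M i j) ^ 2) := by
  unfold frobNorm
  rw [Matrix.frobenius_norm_def, Real.sqrt_eq_rpow]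
  simp

end FrobeniusNorm

section SpectralNorm

open scoped Matrix.Norms.L2Operator

/-- The spectral norm of a real matrix: its operator norm between Euclidean spaces. -/
noncomputable def specNorm {m n : ℕ} (M : Matrix (Fin m) (Fin n) ℝ) : ℝ := ‖M‖

end SpectralNorm

/-- The singular values of a real matrix, in nonincreasing order and indexed from `0`, so that
`sval M j` is the `(j + 1)`-th largest one; it is `0` for `j ≥ rank M`. -/
noncomputable def sval {m n : ℕ} (M : Matrix (Fin m) (Fin n) ℝ) (j : ℕ) : ℝ :=
  (Matrix.toEuclideanLin M).singularValues j

/-- The tail `s_{>k}(M) = (∑_{j > k} s_j ^ 2) ^ (1 / 2)` (with `s_1 ≥ s_2 ≥ ⋯`). An `m × n` matrix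
has no nonzero singular values after the first `n`. -/
noncomputable def svalTail {m n : ℕ} (M : Matrix (Fin m) (Fin n) ℝ) (k : ℕ) : ℝ :=
  √(∑ j ∈ Finset.Ico k n, (sval M j) ^ 2)

/-- The effective rank `r_α(M)`: the least `k` such that the `k` largest singular values carry an
`α`-fraction of the total spectral energy. The quotient is written without division, so that the
zero matrix has effective rank `0`. -/
noncomputable def effRank {m n : ℕ} (α : ℝ) (M : Matrix (Fin m) (Fin n) ℝ) : ℕ :=
  sInf {k : ℕ | α * ∑ j ∈ Finset.range n, (sval M j) ^ 2 ≤ ∑ j ∈ Finset.range k, (sval M j) ^ 2}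

/-- The auto-encoder layer `B σ(A X)`, with `σ` applied entrywise. -/
def autoEnc {r din dout n : ℕ} (σ : ℝ → ℝ) (X : Matrix (Fin din) (Fin n) ℝ)
    (A : Matrix (Fin r) (Fin din) ℝ) (B : Matrix (Fin dout) (Fin r) ℝ) :
    Matrix (Fin dout) (Fin n) ℝ :=
  B * (A * X).map σ

/-- The optimal value `E_σ(r) = min_{A, B} ‖Y - B σ(A X)‖_F` (as an infimum). -/
noncomputable def optError {din dout n : ℕ} (σ : ℝ → ℝ) (r : ℕ)
    (X : Matrix (Fin din) (Fin n) ℝ) (Y : Matrix (Fin dout) (Fin n) ℝ) : ℝ :=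
  ⨅ p : Matrix (Fin r) (Fin din) ℝ × Matrix (Fin dout) (Fin r) ℝ,
    frobNorm (Y - autoEnc σ X p.1 p.2)

/-! Write `L` for the true signal, `N` for the fitted one and `Z` for the truncation of the singular
value decomposition of `Y` at rank `k`. Split `L - N = (L - Z) + (Z - Y) + (Y - N)`. The last two
Frobenius norms are the tail of `Y` and the optimal error. Since `L - Z` has rank at most `r + k`,
its Frobenius norm is at most `√(r + k)` times its spectral norm, which the triangle inequality
bounds by `‖G‖ + ε + s_{k+1}` (`frobNorm_sub_le_of_specNorm_le`).

The only random input is `‖G‖ ≤ 12 v √(n + dout)`, obtained from half-nets of the unit balls and a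
union bound over Gaussian tails (`measureReal_specNorm_gaussian_le`). On that one event every `k` is
allowed, hence every `α`. -/

open Module InnerProductSpace

/-! ### Singular bases, Hilbert–Schmidt sums and truncation -/

section SingularValues

variable {E F : Type*} [NormedAddCommGroup E] [InnerProductSpace ℝ E] [FiniteDimensional ℝ E]
  [NormedAddCommGroup F] [InnerProductSpace ℝ F] [FiniteDimensional ℝ F]

/-- The trace is basis-free, so a Frobenius norm read off in the standard basis can be computed in a
singular basis. -/
theorem LinearMap.sum_norm_sq_eq_trace {ι : Type*} [Fintype ι]
    (T : E →ₗ[ℝ] F) (b : OrthonormalBasis ι ℝ E) :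
    ∑ i, ‖T (b i)‖ ^ 2 = LinearMap.trace ℝ E (LinearMap.adjoint T ∘ₗ T) := by
  rw [LinearMap.trace_eq_sum_inner _ b]
  refine Finset.sum_congr rfl fun i _ ↦ ?_
  rw [LinearMap.comp_apply, LinearMap.adjoint_inner_right, real_inner_self_eq_norm_sq]

/-- The sum of the squared norms of the images of an orthonormal basis does not depend on the
basis. -/
theorem LinearMap.sum_norm_sq_eq_of_orthonormalBasis {ι κ : Type*} [Fintype ι] [Fintype κ]
    (T : E →ₗ[ℝ] F) (b : OrthonormalBasis ι ℝ E) (c : OrthonormalBasis κ ℝ E) :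
    ∑ i, ‖T (b i)‖ ^ 2 = ∑ k, ‖T (c k)‖ ^ 2 := by
  rw [T.sum_norm_sq_eq_trace b, T.sum_norm_sq_eq_trace c]

/-- Right singular vectors: an orthonormal basis with orthogonal images, whose norms are the
singular values. -/
theorem LinearMap.exists_orthonormalBasis_inner_map (T : E →ₗ[ℝ] F) {n : ℕ}
    (hn : finrank ℝ E = n) :
    ∃ b : OrthonormalBasis (Fin n) ℝ E,
      (∀ i j, i ≠ j → ⟪T (b i), T (b j)⟫_ℝ = 0) ∧ ∀ i, ‖T (b i)‖ = T.singularValues i := by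
  have hT := T.isSymmetric_adjoint_comp_self
  have key : ∀ i j, ⟪T (hT.eigenvectorBasis hn i), T (hT.eigenvectorBasis hn j)⟫_ℝ =
      hT.eigenvalues hn j * ⟪hT.eigenvectorBasis hn i, hT.eigenvectorBasis hn j⟫_ℝ := by
    intro i j
    rw [← LinearMap.adjoint_inner_right, ← LinearMap.comp_apply, hT.apply_eigenvectorBasis]
    simp [inner_smul_right]
  refine ⟨hT.eigenvectorBasis hn, fun i j hij ↦ ?_, fun i ↦ ?_⟩
  · rw [key, (hT.eigenvectorBasis hn).orthonormal.2 hij, mul_zero]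
  · have h := key i i
    rw [real_inner_self_eq_norm_sq, real_inner_self_eq_norm_sq,
      (hT.eigenvectorBasis hn).orthonormal.1 i, ← T.sq_singularValues_fin hn i] at h
    nlinarith [norm_nonneg (T (hT.eigenvectorBasis hn i)), T.singularValues_nonneg i]

/-- The Hilbert–Schmidt norm is at most the square root of the rank times the operator norm. -/
theorem LinearMap.sum_norm_sq_le_of_finrank_range_le {ι : Type*} [Fintype ι] (T : E →ₗ[ℝ] F)
    (b : OrthonormalBasis ι ℝ E) {q : ℕ} (hq : finrank ℝ T.range ≤ q) {K : ℝ}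
    (hK : ∀ x, ‖T x‖ ≤ K * ‖x‖) :
    ∑ i, ‖T (b i)‖ ^ 2 ≤ q * K ^ 2 := by
  obtain ⟨c, -, hc⟩ := T.exists_orthonormalBasis_inner_map rfl
  rw [T.sum_norm_sq_eq_of_orthonormalBasis b c]
  -- In a singular basis only the first `rank T` images are nonzero.
  have h : ∀ i, ‖T (c i)‖ ^ 2 ≤ if (i : ℕ) < q then K ^ 2 else 0 := by
    intro i
    split_ifs with hi
    · have := hK (c i)
      rw [c.orthonormal.1 i, mul_one] at this
      gcongr
    · rw [hc, T.singularValues_eq_zero_iff_le_finrank_range.2 (hq.trans (not_lt.1 hi))]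
      simp
  refine (Finset.sum_le_sum fun i _ ↦ h i).trans ?_
  rw [← Finset.sum_filter, Finset.sum_const, nsmul_eq_mul]
  gcongr
  calc _ = ((Finset.univ.filter fun i : Fin (finrank ℝ E) ↦ (i : ℕ) < q).map
        Fin.valEmbedding).card := (Finset.card_map _).symm
    _ ≤ (Finset.range q).card := by
        refine Finset.card_le_card fun x hx ↦ ?_
        simp only [Finset.mem_map, Finset.mem_filter, Finset.mem_univ, true_and,
          Fin.valEmbedding_apply] at hx
        obtain ⟨i, hi, rfl⟩ := hx
        exact Finset.mem_range.2 hi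
    _ = q := Finset.card_range q

/-- Truncation of the singular value decomposition after `k` terms. -/
theorem LinearMap.exists_finrank_range_le_norm_sub_le {ι : Type*} [Fintype ι] (T : E →ₗ[ℝ] F)
    (b : OrthonormalBasis ι ℝ E) {n : ℕ} (hn : finrank ℝ E = n) (k : ℕ) :
    ∃ S : E →ₗ[ℝ] F, finrank ℝ S.range ≤ k ∧
      (∀ x, ‖(T - S) x‖ ≤ T.singularValues k * ‖x‖) ∧
      ∑ i, ‖(T - S) (b i)‖ ^ 2 = ∑ j ∈ Finset.Ico k n, T.singularValues j ^ 2 := by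
  obtain ⟨c, horth, hc⟩ := T.exists_orthonormalBasis_inner_map hn
  -- `S` agrees with `T` on the first `k` right singular vectors and kills the others.
  set S : E →ₗ[ℝ] F := c.toBasis.constr ℝ fun j ↦ if (j : ℕ) < k then T (c j) else 0 with hS
  have hSc : ∀ j, S (c j) = if (j : ℕ) < k then T (c j) else 0 := by
    intro j
    rw [hS, ← c.coe_toBasis, Basis.constr_basis]
  have hTS : ∀ j, (T - S) (c j) = if (j : ℕ) < k then 0 else T (c j) := by
    intro j
    rw [LinearMap.sub_apply, hSc]
    split_ifs <;> simp
  have hnorm : ∀ j, ‖(T - S) (c j)‖ ^ 2 = if (j : ℕ) < k then 0 else T.singularValues j ^ 2 := by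
    intro j
    rw [hTS]
    split_ifs <;> simp [hc]
  refine ⟨S, ?_, fun x ↦ ?_, ?_⟩
  · classical
    -- `k` may exceed the dimension, hence `min k n`.
    set s : Finset F := ((Finset.range (min k n)).attach.image fun j ↦
      T (c ⟨j.1, (Finset.mem_range.1 j.2).trans_le (min_le_right _ _)⟩)) with hs
    have hle : S.range ≤ Submodule.span ℝ (s : Set F) := by
      rw [← Submodule.map_top, ← c.toBasis.span_eq, Submodule.map_span, Submodule.span_le]
      rintro _ ⟨_, ⟨j, rfl⟩, rfl⟩
      rw [c.coe_toBasis, hSc]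
      split_ifs with hj
      · refine Submodule.subset_span ?_
        rw [hs, Finset.mem_coe, Finset.mem_image]
        exact ⟨⟨j, Finset.mem_range.2 (lt_min hj j.2)⟩, Finset.mem_attach _ _, rfl⟩
      · exact Submodule.zero_mem _
    calc finrank ℝ S.range ≤ finrank ℝ (Submodule.span ℝ (s : Set F)) :=
          Submodule.finrank_mono hle
      _ ≤ s.card := finrank_span_finset_le_card s
      _ ≤ (Finset.range (min k n)).attach.card := Finset.card_image_le
      _ ≤ k := by simp
  · have hx : (T - S) x = ∑ j, ⟪c j, x⟫_ℝ • (T - S) (c j) := by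
      conv_lhs => rw [← c.sum_repr' x]
      simp only [map_sum, map_smul]
    -- Orthogonality of the images removes the cross terms.
    have hsq : ‖(T - S) x‖ ^ 2 = ∑ j, ⟪c j, x⟫_ℝ ^ 2 * ‖(T - S) (c j)‖ ^ 2 := by
      rw [← real_inner_self_eq_norm_sq, hx, sum_inner]
      refine Finset.sum_congr rfl fun i _ ↦ ?_
      rw [inner_sum, Finset.sum_eq_single i]
      · rw [real_inner_smul_left, real_inner_smul_right, real_inner_self_eq_norm_sq]
        ring
      · intro j _ hj
        rw [real_inner_smul_left, real_inner_smul_right, hTS, hTS]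
        split_ifs <;> simp [horth i j hj.symm]
      · simp
    refine abs_le_of_sq_le_sq' ?_ (mul_nonneg (T.singularValues_nonneg k) (norm_nonneg x)) |>.2
    rw [hsq, mul_pow, ← c.sum_sq_inner_right x, Finset.mul_sum]
    refine Finset.sum_le_sum fun j _ ↦ ?_
    rw [mul_comm]
    refine mul_le_mul_of_nonneg_right ?_ (sq_nonneg _)
    rw [hnorm]
    split_ifs with hj
    · positivity
    · have := T.singularValues_antitone (not_lt.1 hj)
      have := T.singularValues_nonneg j
      gcongr
  · rw [(T - S).sum_norm_sq_eq_of_orthonormalBasis b c]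
    simp only [hnorm]
    rw [Fin.sum_univ_eq_sum_range (fun j ↦ if j < k then 0 else T.singularValues j ^ 2) n,
      ← Finset.sum_filter_add_sum_filter_not (Finset.range n) (fun j ↦ j < k)]
    rw [Finset.sum_congr rfl (g := fun _ ↦ (0 : ℝ)) fun j hj ↦ if_pos (Finset.mem_filter.1 hj).2,
      Finset.sum_const_zero, zero_add]
    refine Finset.sum_congr ?_ fun j hj ↦ if_neg (not_lt.2 (Finset.mem_Ico.1 hj).1)
    ext j
    simp
    tauto

end SingularValues

/-! ### Frobenius against spectral norm; the deterministic bound -/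

section MatrixNorms

variable {m n : ℕ}

theorem frobNorm_add_le (M N : Matrix (Fin m) (Fin n) ℝ) :
    frobNorm (M + N) ≤ frobNorm M + frobNorm N := by
  open scoped Matrix.Norms.Frobenius in exact norm_add_le M N

theorem specNorm_nonneg (M : Matrix (Fin m) (Fin n) ℝ) : 0 ≤ specNorm M := by
  open scoped Matrix.Norms.L2Operator in exact norm_nonneg M

theorem specNorm_neg (M : Matrix (Fin m) (Fin n) ℝ) : specNorm (-M) = specNorm M := by
  open scoped Matrix.Norms.L2Operator in exact norm_neg M

theorem specNorm_add_le (M N : Matrix (Fin m) (Fin n) ℝ) :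
    specNorm (M + N) ≤ specNorm M + specNorm N := by
  open scoped Matrix.Norms.L2Operator in exact norm_add_le M N

theorem specNorm_eq_norm_toContinuousLinearMap (M : Matrix (Fin m) (Fin n) ℝ) :
    specNorm M = ‖(Matrix.toEuclideanLin M).toContinuousLinearMap‖ := rfl

theorem norm_toEuclideanLin_apply_le (M : Matrix (Fin m) (Fin n) ℝ)
    (x : EuclideanSpace ℝ (Fin n)) : ‖Matrix.toEuclideanLin M x‖ ≤ specNorm M * ‖x‖ :=
  (Matrix.toEuclideanLin M).toContinuousLinearMap.le_opNorm x

theorem frobNorm_eq_sqrt_sum_norm_sq (M : Matrix (Fin m) (Fin n) ℝ) :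
    frobNorm M = √(∑ j, ‖Matrix.toEuclideanLin M (EuclideanSpace.basisFun (Fin n) ℝ j)‖ ^ 2) := by
  rw [frobNorm_eq_sqrt, Finset.sum_comm]
  congr 1
  refine Finset.sum_congr rfl fun j _ ↦ ?_
  rw [EuclideanSpace.norm_sq_eq]
  refine Finset.sum_congr rfl fun i _ ↦ ?_
  simp [Matrix.toLpLin_apply]

theorem finrank_range_toEuclideanLin (M : Matrix (Fin m) (Fin n) ℝ) :
    finrank ℝ (Matrix.toEuclideanLin M).range = M.rank := by
  rw [Matrix.toEuclideanLin_eq_toLin_orthonormal, ← Matrix.rank_eq_finrank_range_toLin]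

theorem frobNorm_le_sqrt_mul_specNorm (M : Matrix (Fin m) (Fin n) ℝ) {q : ℕ} (hq : M.rank ≤ q) :
    frobNorm M ≤ √q * specNorm M := by
  rw [frobNorm_eq_sqrt_sum_norm_sq]
  refine Real.sqrt_le_iff.2 ⟨mul_nonneg (Real.sqrt_nonneg _) (specNorm_nonneg M), ?_⟩
  rw [mul_pow, Real.sq_sqrt (Nat.cast_nonneg q)]
  exact (Matrix.toEuclideanLin M).sum_norm_sq_le_of_finrank_range_le _
    ((finrank_range_toEuclideanLin M).trans_le hq) (norm_toEuclideanLin_apply_le M)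

theorem exists_rank_le_specNorm_sub_le (M : Matrix (Fin m) (Fin n) ℝ) (k : ℕ) :
    ∃ Z : Matrix (Fin m) (Fin n) ℝ, Z.rank ≤ k ∧ specNorm (M - Z) ≤ sval M k ∧
      frobNorm (M - Z) = svalTail M k := by
  obtain ⟨S, hS, hop, hsum⟩ := (Matrix.toEuclideanLin M).exists_finrank_range_le_norm_sub_le
    (EuclideanSpace.basisFun (Fin n) ℝ) (n := n) (by simp) k
  have hsub : Matrix.toEuclideanLin (M - Matrix.toEuclideanLin.symm S) =
      Matrix.toEuclideanLin M - S := by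
    rw [map_sub, LinearEquiv.apply_symm_apply]
  refine ⟨Matrix.toEuclideanLin.symm S, ?_, ?_, ?_⟩
  · rwa [← finrank_range_toEuclideanLin, LinearEquiv.apply_symm_apply]
  · rw [specNorm_eq_norm_toContinuousLinearMap, hsub]
    exact ContinuousLinearMap.opNorm_le_bound _ (LinearMap.singularValues_nonneg _ k) hop
  · rw [frobNorm_eq_sqrt_sum_norm_sq, hsub, hsum]
    rfl

theorem rank_autoEnc_le {r din : ℕ} (σ : ℝ → ℝ) (X : Matrix (Fin din) (Fin n) ℝ)
    (A : Matrix (Fin r) (Fin din) ℝ) (B : Matrix (Fin m) (Fin r) ℝ) :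
    (autoEnc σ X A B).rank ≤ r :=
  (Matrix.rank_mul_le_left _ _).trans (Matrix.rank_le_width _)

theorem rank_sub_le_add_rank (M N : Matrix (Fin m) (Fin n) ℝ) :
    (M - N).rank ≤ M.rank + N.rank := by
  simp only [← finrank_range_toEuclideanLin]
  refine (Submodule.finrank_mono ?_).trans (Submodule.finrank_add_le_finrank_add_finrank _ _)
  rintro _ ⟨x, rfl⟩
  rw [map_sub, LinearMap.sub_apply]
  exact sub_mem (Submodule.mem_sup_left (LinearMap.mem_range_self _ x))
    (Submodule.mem_sup_right (LinearMap.mem_range_self _ x))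

/-- The deterministic part of the recovery bound: `L` has low rank and is spectrally close to
`Y - G`. -/
theorem frobNorm_sub_le_of_specNorm_le (L N Y G : Matrix (Fin m) (Fin n) ℝ) {r : ℕ}
    (hL : L.rank ≤ r) {ε g : ℝ} (hε : specNorm (Y - L - G) ≤ ε) (hG : specNorm G ≤ g) (k : ℕ) :
    frobNorm (L - N) ≤ √((r : ℝ) + k) * (g + ε + sval Y k) + svalTail Y k + frobNorm (Y - N) := by
  obtain ⟨Z, hZ, hZs, hZf⟩ := exists_rank_le_specNorm_sub_le Y k
  have hrank : (L - Z).rank ≤ r + k := (rank_sub_le_add_rank L Z).trans (add_le_add hL hZ)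
  have hspec : specNorm (L - Z) ≤ g + ε + sval Y k := by
    have heq : L - Z = -(Y - L - G) + -G + (Y - Z) := by abel
    have h₁ := specNorm_add_le (-(Y - L - G) + -G) (Y - Z)
    have h₂ := specNorm_add_le (-(Y - L - G)) (-G)
    rw [specNorm_neg, specNorm_neg] at h₂
    rw [heq]
    linarith
  have hfrob := frobNorm_le_sqrt_mul_specNorm (L - Z) hrank
  push_cast at hfrob
  have hmul := mul_le_mul_of_nonneg_left hspec (Real.sqrt_nonneg ((r : ℝ) + k))
  have hZf' : frobNorm (Z - Y) = svalTail Y k := by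
    rw [← hZf, ← neg_sub]
    open scoped Matrix.Norms.Frobenius in exact norm_neg _
  have heq : L - N = (L - Z) + (Z - Y) + (Y - N) := by abel
  have h₁ := frobNorm_add_le ((L - Z) + (Z - Y)) (Y - N)
  have h₂ := frobNorm_add_le (L - Z) (Z - Y)
  rw [heq]
  linarith

end MatrixNorms

/-! ### Nets and operator norms -/

section Nets

/-- The unit ball has a `1 / 2`-net with at most `5 ^ dim` points. -/
theorem exists_finset_norm_sub_le_half (E : Type*) [NormedAddCommGroup E] [NormedSpace ℝ E]
    [FiniteDimensional ℝ E] :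
    ∃ s : Finset E, s.card ≤ 5 ^ finrank ℝ E ∧ (∀ c ∈ s, ‖c‖ ≤ 1) ∧
      ∀ x : E, ‖x‖ ≤ 1 → ∃ c ∈ s, ‖x - c‖ ≤ 1 / 2 := by
  classical
  -- A separated set of maximal size is a net. The cardinality bound is for separation `1` in radius
  -- `2`, hence the scaling by `2`.
  let p : ℕ → Prop := fun k ↦ ∃ s : Finset E, s.card = k ∧ (∀ c ∈ s, ‖c‖ ≤ 1) ∧
    ∀ c ∈ s, ∀ d ∈ s, c ≠ d → 1 / 2 ≤ ‖c - d‖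
  have hp : ∀ k, p k → k ≤ 5 ^ finrank ℝ E := by
    rintro _ ⟨s, rfl, hs, hsep⟩
    have hinj : Function.Injective fun x : E ↦ (2 : ℝ) • x := smul_right_injective E two_ne_zero
    rw [← Finset.card_image_of_injective s hinj]
    refine Besicovitch.card_le_of_separated _ ?_ ?_
    · simp only [Finset.forall_mem_image]
      intro c hc
      rw [norm_smul, Real.norm_ofNat]
      linarith [hs c hc]
    · simp only [Finset.forall_mem_image]
      intro c hc d hd hne
      rw [← smul_sub, norm_smul, Real.norm_ofNat]
      linarith [hsep c hc d hd fun h ↦ hne (h ▸ rfl)]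
  have h0 : p 0 := ⟨∅, by simp⟩
  obtain ⟨s, hcard, hs, hsep⟩ := Nat.findGreatest_spec (P := p) (Nat.zero_le (5 ^ finrank ℝ E)) h0
  refine ⟨s, hcard ▸ Nat.findGreatest_le _, hs, fun x hx ↦ ?_⟩
  by_contra! hfar
  have hxs : x ∉ s := fun h ↦ by simpa using (hfar x h).le.trans_lt' (by norm_num : (0 : ℝ) < 1 / 2)
  have hnew : p (s.card + 1) := by
    refine ⟨insert x s, Finset.card_insert_of_notMem hxs, ?_, ?_⟩
    · simpa using ⟨hx, hs⟩
    · intro c hc d hd hne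
      rcases Finset.mem_insert.1 hc with rfl | hc' <;> rcases Finset.mem_insert.1 hd with rfl | hd'
      · exact absurd rfl hne
      · exact (hfar d hd').le
      · rw [norm_sub_rev]
        exact (hfar c hc').le
      · exact hsep c hc' d hd' hne
  have := Nat.le_findGreatest (hp _ hnew) hnew
  omega

variable {E F : Type*} [NormedAddCommGroup E] [InnerProductSpace ℝ E]
  [NormedAddCommGroup F] [InnerProductSpace ℝ F]

/-- Replacing `y / ‖y‖` by a net point costs at most `‖y‖ / 2`. -/
theorem norm_le_two_mul_of_net {t : Finset F} (ht : ∀ x : F, ‖x‖ ≤ 1 → ∃ c ∈ t, ‖x - c‖ ≤ 1 / 2)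
    {K : ℝ} (y : F) (hy : ∀ d ∈ t, ⟪d, y⟫_ℝ ≤ K) : ‖y‖ ≤ 2 * K := by
  obtain ⟨d, hd, hdy⟩ := ht (‖y‖⁻¹ • y) (by
    rw [norm_smul, norm_inv, norm_norm]
    exact inv_mul_le_one)
  have h₁ : ⟪‖y‖⁻¹ • y, y⟫_ℝ = ‖y‖ := by
    rw [real_inner_smul_left, real_inner_self_eq_norm_sq]
    rcases eq_or_ne ‖y‖ 0 with h | h
    · simp [h]
    · field_simp
  have h₂ := real_inner_le_norm (‖y‖⁻¹ • y - d) y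
  rw [inner_sub_left, h₁] at h₂
  nlinarith [hy d hd, mul_le_mul_of_nonneg_right hdy (norm_nonneg y)]

/-- Each of the two nets loses a factor `2`. -/
theorem ContinuousLinearMap.opNorm_le_of_net {s : Finset E} {t : Finset F}
    (hs : ∀ x : E, ‖x‖ ≤ 1 → ∃ c ∈ s, ‖x - c‖ ≤ 1 / 2)
    (ht : ∀ x : F, ‖x‖ ≤ 1 → ∃ c ∈ t, ‖x - c‖ ≤ 1 / 2) {K : ℝ} (L : E →L[ℝ] F)
    (hL : ∀ c ∈ s, ∀ d ∈ t, ⟪d, L c⟫_ℝ ≤ K) : ‖L‖ ≤ 4 * K := by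
  have hK : ∀ c ∈ s, ‖L c‖ ≤ 2 * K := fun c hc ↦ norm_le_two_mul_of_net ht _ (hL c hc)
  have hunit : ∀ x : E, ‖x‖ ≤ 1 → ‖L x‖ ≤ 2 * K + ‖L‖ * (1 / 2) := by
    intro x hx
    obtain ⟨c, hc, hxc⟩ := hs x hx
    calc ‖L x‖ = ‖L c + L (x - c)‖ := by rw [← map_add, add_sub_cancel]
      _ ≤ ‖L c‖ + ‖L (x - c)‖ := norm_add_le _ _
      _ ≤ 2 * K + ‖L‖ * (1 / 2) := add_le_add (hK c hc) (L.le_opNorm_of_le hxc)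
  have h0 : 0 ≤ 2 * K + ‖L‖ * (1 / 2) := (norm_nonneg _).trans (hunit 0 (by simp))
  have := ContinuousLinearMap.opNorm_le_of_unit_norm h0 fun x hx ↦ hunit x hx.le
  linarith

end Nets

/-! ### Spectral norm of a Gaussian matrix -/

section GaussianMatrix

variable {Ω : Type*} [MeasurableSpace Ω] {P : Measure Ω}

theorem ProbabilityTheory.HasSubgaussianMGF.mono_param {X : Ω → ℝ} {c d : ℝ≥0}
    (h : HasSubgaussianMGF X c P) (hcd : c ≤ d) : HasSubgaussianMGF X d P :=
  ⟨h.integrable_exp_mul, fun t ↦ (h.mgf_le t).trans (by gcongr)⟩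

theorem ProbabilityTheory.HasLaw.hasSubgaussianMGF_gaussianReal {X : Ω → ℝ} {c : ℝ≥0}
    (h : HasLaw X (gaussianReal 0 c) P) : HasSubgaussianMGF X c P := by
  rw [← HasSubgaussianMGF.id_map_iff h.aemeasurable, h.map_eq]
  refine ⟨fun t ↦ integrable_exp_mul_gaussianReal t, fun t ↦ ?_⟩
  rw [mgf_id_gaussianReal]
  simp

variable {m n : ℕ} {v : ℝ≥0} {G : Ω → Matrix (Fin m) (Fin n) ℝ}

/-- The form is a sum of independent `d i * c j * G i j`, of total variance `v² ‖d‖² ‖c‖² ≤ v²`. -/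
theorem hasSubgaussianMGF_inner_toEuclideanLin
    (hlaw : ∀ i j, HasLaw (fun ω ↦ G ω i j) (gaussianReal 0 (v ^ 2)) P)
    (hind : iIndepFun (fun (p : Fin m × Fin n) (ω : Ω) ↦ G ω p.1 p.2) P)
    {c : EuclideanSpace ℝ (Fin n)} (hc : ‖c‖ ≤ 1) {d : EuclideanSpace ℝ (Fin m)} (hd : ‖d‖ ≤ 1) :
    HasSubgaussianMGF (fun ω ↦ ⟪d, Matrix.toEuclideanLin (G ω) c⟫_ℝ) (v ^ 2) P := by
  have hind' : iIndepFun (fun (p : Fin m × Fin n) (ω : Ω) ↦ (d p.1 * c p.2) * G ω p.1 p.2) P :=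
    hind.comp (fun p x ↦ (d p.1 * c p.2) * x) fun p ↦ measurable_const_mul _
  have h := HasSubgaussianMGF.sum_of_iIndepFun hind' (s := Finset.univ) fun p _ ↦
    ((hlaw p.1 p.2).hasSubgaussianMGF_gaussianReal.const_mul (d p.1 * c p.2)).mono_param
      (d := ‖d p.1 * c p.2‖₊ ^ 2 * v ^ 2)
      (NNReal.coe_le_coe.1 (by
        change (d p.1 * c p.2) ^ 2 * (v : ℝ) ^ 2 ≤ ‖d p.1 * c p.2‖ ^ 2 * (v : ℝ) ^ 2
        rw [Real.norm_eq_abs, sq_abs]))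
  have heq : (fun ω ↦ ⟪d, Matrix.toEuclideanLin (G ω) c⟫_ℝ) =
      fun ω ↦ ∑ p : Fin m × Fin n, (d p.1 * c p.2) * G ω p.1 p.2 := by
    funext ω
    rw [Fintype.sum_prod_type, PiLp.inner_apply]
    refine Finset.sum_congr rfl fun i _ ↦ ?_
    simp only [Matrix.toLpLin_apply, Matrix.mulVec, dotProduct,
      RCLike.inner_apply, conj_trivial, Finset.sum_mul]
    exact Finset.sum_congr rfl fun j _ ↦ by ring
  rw [heq]
  refine h.mono_param ?_
  rw [← NNReal.coe_le_coe]
  push_cast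
  simp only [Real.norm_eq_abs, sq_abs]
  rw [← Finset.sum_mul]
  refine mul_le_of_le_one_left (by positivity) ?_
  have hsum : ∑ p : Fin m × Fin n, (d p.1 * c p.2) ^ 2 = ‖d‖ ^ 2 * ‖c‖ ^ 2 := by
    rw [EuclideanSpace.real_norm_sq_eq, EuclideanSpace.real_norm_sq_eq, Finset.sum_mul_sum,
      Fintype.sum_prod_type]
    simp only [mul_pow]
  exact hsum.trans_le (mul_le_one₀ (pow_le_one₀ (norm_nonneg _) hd) (sq_nonneg _)
    (pow_le_one₀ (norm_nonneg _) hc))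

/-- The spectral norm of a Gaussian matrix is of order `√(n + m)` with overwhelming probability. -/
theorem measureReal_specNorm_gaussian_le [IsProbabilityMeasure P]
    (hlaw : ∀ i j, HasLaw (fun ω ↦ G ω i j) (gaussianReal 0 (v ^ 2)) P)
    (hind : iIndepFun (fun (p : Fin m × Fin n) (ω : Ω) ↦ G ω p.1 p.2) P) :
    P.real {ω | ¬ specNorm (G ω) ≤ 12 * (v : ℝ) * √((n : ℝ) + m)} ≤
      Real.exp (-((n : ℝ) + m)) := by
  -- The tail exponent divides by `v²`, so the degenerate case is separate.
  rcases eq_or_ne v 0 with rfl | hv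
  · have hzero : ∀ᵐ ω ∂P, G ω = 0 := by
      have hij : ∀ i j, ∀ᵐ ω ∂P, G ω i j = 0 := fun i j ↦
        HasSubgaussianMGF.ae_eq_zero_of_hasSubgaussianMGF_zero
          (by simpa using (hlaw i j).hasSubgaussianMGF_gaussianReal)
      have hall := ae_all_iff.2 fun i ↦ ae_all_iff.2 (hij i)
      filter_upwards [hall] with ω hω
      ext i j
      exact hω i j
    have hnull : P {ω | ¬ specNorm (G ω) ≤ 12 * ((0 : ℝ≥0) : ℝ) * √((n : ℝ) + m)} = 0 := by
      rw [← ae_iff]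
      filter_upwards [hzero] with ω hω
      have : specNorm (0 : Matrix (Fin m) (Fin n) ℝ) = 0 := by
        open scoped Matrix.Norms.L2Operator in exact norm_zero
      simp [hω, this]
    rw [measureReal_def, hnull]
    simpa using (Real.exp_pos _).le
  obtain ⟨s, hscard, hs1, hs⟩ := exists_finset_norm_sub_le_half (EuclideanSpace ℝ (Fin n))
  obtain ⟨t, htcard, ht1, ht⟩ := exists_finset_norm_sub_le_half (EuclideanSpace ℝ (Fin m))
  rw [finrank_euclideanSpace_fin] at hscard htcard
  -- `12 = 4 * 3`, with `4` from the nets. The tail exponent `K² / (2 v²) = 9/2 (n + m)` beats the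
  -- `5 ^ (n + m) ≤ exp (2 (n + m))` pairs.
  set K : ℝ := 3 * v * √((n : ℝ) + m) with hKdef
  have hvpos : (0 : ℝ) < v := by positivity
  have hNnn : (0 : ℝ) ≤ (n : ℝ) + m := by positivity
  have hsub : {ω | ¬ specNorm (G ω) ≤ 12 * (v : ℝ) * √((n : ℝ) + m)} ⊆
      ⋃ q ∈ s ×ˢ t, {ω | K ≤ ⟪q.2, Matrix.toEuclideanLin (G ω) q.1⟫_ℝ} := by
    intro ω hω
    by_contra hno
    simp only [Set.mem_iUnion, Set.mem_ofPred_eq, not_exists, not_le, Finset.mem_product] at hno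
    refine hω ?_
    rw [specNorm_eq_norm_toContinuousLinearMap]
    refine (ContinuousLinearMap.opNorm_le_of_net hs ht (K := K) _ fun c hc d hd ↦
      (hno (c, d) ⟨hc, hd⟩).le).trans_eq ?_
    rw [hKdef]
    ring
  have htail : ∀ q ∈ s ×ˢ t, P.real {ω | K ≤ ⟪q.2, Matrix.toEuclideanLin (G ω) q.1⟫_ℝ} ≤
      Real.exp (-(9 / 2 * ((n : ℝ) + m))) := by
    intro q hq
    rw [Finset.mem_product] at hq
    refine ((hasSubgaussianMGF_inner_toEuclideanLin hlaw hind (hs1 _ hq.1)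
      (ht1 _ hq.2)).measure_ge_le (ε := K) (by positivity)).trans_eq ?_
    congr 1
    rw [hKdef, mul_pow, mul_pow, Real.sq_sqrt hNnn]
    push_cast
    field_simp
    ring
  have hexp : (5 : ℝ) ≤ Real.exp 2 := by
    have h1 := Real.exp_one_gt_d9
    have h2 : Real.exp 2 = Real.exp 1 * Real.exp 1 := by rw [← Real.exp_add]; norm_num
    nlinarith
  have hcard : ((s ×ˢ t).card : ℝ) ≤ Real.exp (2 * ((n : ℝ) + m)) := by
    calc ((s ×ˢ t).card : ℝ) ≤ ((5 ^ n * 5 ^ m : ℕ) : ℝ) := by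
          rw [Finset.card_product]
          exact_mod_cast Nat.mul_le_mul hscard htcard
      _ = (5 : ℝ) ^ (n + m) := by push_cast; rw [pow_add]
      _ ≤ Real.exp 2 ^ (n + m) := by gcongr
      _ = Real.exp (2 * ((n : ℝ) + m)) := by rw [← Real.exp_nat_mul]; push_cast; ring_nf
  calc P.real {ω | ¬ specNorm (G ω) ≤ 12 * (v : ℝ) * √((n : ℝ) + m)}
      ≤ P.real (⋃ q ∈ s ×ˢ t, {ω | K ≤ ⟪q.2, Matrix.toEuclideanLin (G ω) q.1⟫_ℝ}) :=
        measureReal_mono hsub (measure_ne_top P _)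
    _ ≤ ∑ q ∈ s ×ˢ t, P.real {ω | K ≤ ⟪q.2, Matrix.toEuclideanLin (G ω) q.1⟫_ℝ} :=
        measureReal_biUnion_finset_le _ _
    _ ≤ (s ×ˢ t).card * Real.exp (-(9 / 2 * ((n : ℝ) + m))) := by
        rw [← nsmul_eq_mul]
        exact Finset.sum_le_card_nsmul _ _ _ htail
    _ ≤ Real.exp (2 * ((n : ℝ) + m)) * Real.exp (-(9 / 2 * ((n : ℝ) + m))) := by gcongr
    _ = Real.exp (2 * ((n : ℝ) + m) + -(9 / 2 * ((n : ℝ) + m))) := (Real.exp_add _ _).symm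
    _ ≤ Real.exp (-((n : ℝ) + m)) := Real.exp_le_exp.2 (by linarith)

end GaussianMatrix

/-! ### The recovery theorem -/

theorem theorem2 :
    ∃ C : ℝ, 0 < C ∧
      ∀ {Ω : Type*} [MeasurableSpace Ω] (P : Measure Ω) [IsProbabilityMeasure P]
        (din dout n r : ℕ) (σ : ℝ → ℝ) (X : Matrix (Fin din) (Fin n) ℝ)
        (Atrue : Matrix (Fin r) (Fin din) ℝ) (Btrue : Matrix (Fin dout) (Fin r) ℝ)
        (v : ℝ≥0) (ε : ℝ) (G Y : Ω → Matrix (Fin dout) (Fin n) ℝ),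
        (∀ i j, HasLaw (fun ω => G ω i j) (gaussianReal 0 (v ^ 2)) P) →
        iIndepFun (fun (p : Fin dout × Fin n) (ω : Ω) => G ω p.1 p.2) P →
        (∀ᵐ ω ∂P, specNorm (Y ω - autoEnc σ X Atrue Btrue - G ω) ≤ ε) →
        ∃ S : Set Ω, MeasurableSet S ∧
          1 - 2 * Real.exp (-((n : ℝ) + (dout : ℝ))) ≤ P.real S ∧
          ∀ ω ∈ S, ∀ α : ℝ, 0 < α → α ≤ 1 →
            ∀ (Astar : Matrix (Fin r) (Fin din) ℝ) (Bstar : Matrix (Fin dout) (Fin r) ℝ),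
              frobNorm (Y ω - autoEnc σ X Astar Bstar) = optError σ r X (Y ω) →
              frobNorm (autoEnc σ X Atrue Btrue - autoEnc σ X Astar Bstar) ≤
                √((r : ℝ) + (effRank α (Y ω) : ℝ)) *
                    (C * (v : ℝ) * √((n : ℝ) + (dout : ℝ)) + ε + sval (Y ω) (effRank α (Y ω)))
                  + svalTail (Y ω) (effRank α (Y ω)) + optError σ r X (Y ω) := by
  refine ⟨12, by norm_num, ?_⟩
  intro Ω _ P _ din dout n r σ X Atrue Btrue v ε G Y hlaw hind hclose
  set N : Set Ω := {ω | ¬ specNorm (G ω) ≤ 12 * (v : ℝ) * √((n : ℝ) + dout)} ∪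
    {ω | ¬ specNorm (Y ω - autoEnc σ X Atrue Btrue - G ω) ≤ ε} with hN
  have hPN : P.real N ≤ Real.exp (-((n : ℝ) + dout)) := by
    refine (measureReal_union_le _ _).trans ?_
    have hnull : P.real {ω | ¬ specNorm (Y ω - autoEnc σ X Atrue Btrue - G ω) ≤ ε} = 0 := by
      rw [measureReal_def, ae_iff.1 hclose, ENNReal.toReal_zero]
    rw [hnull, add_zero]
    exact measureReal_specNorm_gaussian_le hlaw hind
  -- `N` need not be measurable; its measurable hull has the same measure.
  refine ⟨(toMeasurable P N)ᶜ, (measurableSet_toMeasurable P N).compl, ?_, ?_⟩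
  · rw [probReal_compl_eq_one_sub (measurableSet_toMeasurable P N), measureReal_def,
      measure_toMeasurable, ← measureReal_def]
    linarith [Real.exp_pos (-((n : ℝ) + dout))]
  · intro ω hω α _ _ Astar Bstar hopt
    have hωN : ω ∉ N := fun h ↦ hω (subset_toMeasurable P N h)
    simp only [hN, Set.mem_union, Set.mem_ofPred_eq, not_or, not_not] at hωN
    rw [← hopt]
    exact frobNorm_sub_le_of_specNorm_le _ _ _ _ (rank_autoEnc_le σ X Atrue Btrue) hωN.2 hωN.1 _
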